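/- Let $\mathbb F$ be $\mathbb R$, $\mathbb C$, the quaternions $\mathbb H$ or the octonions $\mathbb O$, and let $d\ge 1$ be an integer, with $d\in\{1,2\}$ if $\mathbb F=\mathbb O$. Let $\mathbb{FP}^d$ be the projective space over $\mathbb F$, realized as the set of Hermitian $(d+1)\times(d+1)$ matrices $p$ over $\mathbb F$ with $p^2=p$ and $\operatorname{tr}p=1$ (for $\mathbb F\neq\mathbb O$, the orthogonal projections $xx^*$ onto the lines of $\mathbb F^{d+1}$, $|x|=1$). Let $\vartheta(p,q)\in[0,\pi]$ be the geodesic distance normalized so that the diameter is $\pi$, that is, $\cos\vartheta(p,q)=2\operatorname{Re}\operatorname{tr}(pq)-1$ (which equals $2|x\cdot y|^2-1$ if $p=xx^*$, $q=yy^*$). For $s<0$ put $F_s(t)=\frac1s(\arccos t)^{-s}$ for $t\in[-1,1]$, and for a Borel probability measure $\mu$ on $\mathbb{FP}^d$ put $$I_{F_s}(\mu)=\int_{\mathbb{FP}^d}\int_{\mathbb{FP}^d}F_s(\cos\vartheta(x,y))\,d\mu(x)\,d\mu(y).$$ A measure is said to be of the form $\mu_{ONB}$ if it equals $\frac1{d+1}\sum_{j=1}^{d+1}\delta_{e_j}$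 for some points $e_1,\dots,e_{d+1}\in\mathbb{FP}^d$ with $\vartheta(e_i,e_j)=\pi$ for all $i\ne j$. **Theorem.** For each such $\mathbb F$ and $d$ there exists a unique $s^*\in[-2,-1]$ such that - for every $s<s^*$, $I_{F_s}$ attains its minimum over the Borel probability measures on $\mathbb{FP}^d$, and its minimizers are exactly the measures of the form $\mu_{ONB}$; - for every $s$ with $s^*<s<0$, no measure of the form $\mu_{ONB}$ is a minimizer of $I_{F_s}$. -/

import Mathlib

open scoped Quaternion

noncomputable section

/-! ### Octonions -/

/-- The octonions, as the Cayley-Dickson double `ℍ × ℍ` of the quaternions, with the Euclidean norm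
and inner product of `ℝ⁸`. -/
def Octonion : Type := WithLp 2 (ℍ × ℍ)

namespace Octonion

instance : NormedAddCommGroup Octonion := inferInstanceAs (NormedAddCommGroup (WithLp 2 (ℍ × ℍ)))

instance : InnerProductSpace ℝ Octonion :=
  inferInstanceAs (InnerProductSpace ℝ (WithLp 2 (ℍ × ℍ)))

/-- The octonion `a + b ℓ`. -/
def mk (a b : ℍ) : Octonion := WithLp.toLp 2 (a, b)

/-- First quaternionic component. -/
def left (x : Octonion) : ℍ := WithLp.fst x

/-- Second quaternionic component. -/
def right (x : Octonion) : ℍ := WithLp.snd x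

@[ext] theorem ext {x y : Octonion} (h₁ : x.left = y.left) (h₂ : x.right = y.right) : x = y :=
  WithLp.ofLp_injective 2 (Prod.ext h₁ h₂)

@[simp] theorem left_mk (a b : ℍ) : (mk a b).left = a := rfl
@[simp] theorem right_mk (a b : ℍ) : (mk a b).right = b := rfl
@[simp] theorem left_add (x y : Octonion) : (x + y).left = x.left + y.left := rfl
@[simp] theorem right_add (x y : Octonion) : (x + y).right = x.right + y.right := rfl
@[simp] theorem left_zero : (0 : Octonion).left = 0 := rfl
@[simp] theorem right_zero : (0 : Octonion).right = 0 := rfl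

/-- Cayley-Dickson multiplication `(a, b) (c, d) = (a c - d* b, d a + b c*)`. -/
instance : Mul Octonion :=
  ⟨fun x y => mk (x.left * y.left - star y.right * x.right)
    (y.right * x.left + x.right * star y.left)⟩

instance : One Octonion := ⟨mk 1 0⟩

/-- Octonionic conjugation `(a, b)* = (a*, -b)`. -/
instance : Star Octonion := ⟨fun x => mk (star x.left) (-x.right)⟩

@[simp] theorem left_mul (x y : Octonion) :
    (x * y).left = x.left * y.left - star y.right * x.right := rfl
@[simp] theorem right_mul (x y : Octonion) :
    (x * y).right = y.right * x.left + x.right * star y.left := rfl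
@[simp] theorem left_one : (1 : Octonion).left = 1 := rfl
@[simp] theorem right_one : (1 : Octonion).right = 0 := rfl
@[simp] theorem left_star (x : Octonion) : (star x).left = star x.left := rfl
@[simp] theorem right_star (x : Octonion) : (star x).right = -x.right := rfl

instance : NonAssocRing Octonion where
  left_distrib x y z := by
    ext1 <;> simp only [left_mul, right_mul, left_add, right_add, star_add] <;> noncomm_ring
  right_distrib x y z := by
    ext1 <;> simp only [left_mul, right_mul, left_add, right_add] <;> noncomm_ring
  zero_mul x := by ext1 <;> simp
  mul_zero x := by ext1 <;> simp
  one_mul x := by ext1 <;> simp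
  mul_one x := by ext1 <;> simp

instance : StarRing Octonion where
  star_involutive x := by ext1 <;> simp
  star_mul x y := by
    ext1 <;> simp only [left_mul, right_mul, left_star, right_star, star_mul, star_sub, star_neg,
      star_star] <;> noncomm_ring
  star_add x y := by
    ext1 <;> simp only [left_star, right_star, left_add, right_add, star_add, neg_add]

end Octonion

/-! ### Projective spaces -/

section ProjectiveSpace

variable (𝔽 : Type) [NonAssocRing 𝔽] [Star 𝔽]

/-- The projective space `𝔽P^d`: the Hermitian idempotents of trace one among the
`(d + 1) × (d + 1)` matrices over `𝔽`. For `𝔽 = ℝ, ℂ, ℍ` these are the orthogonal projections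
`x x*` onto the lines of `𝔽^(d+1)`, with `x` a unit vector (see `real_iff_line`,
`complex_iff_line`, `quaternion_iff_line` below). For `𝔽` the octonions and `d = 1, 2` this is
the standard model of the octonionic projective line and of the Cayley plane. -/
def ProjSpace (d : ℕ) : Type :=
  {p : Matrix (Fin (d + 1)) (Fin (d + 1)) 𝔽 // p.IsHermitian ∧ p * p = p ∧ p.trace = 1}

variable {𝔽} {d : ℕ}

instance [TopologicalSpace 𝔽] : TopologicalSpace (ProjSpace 𝔽 d) :=
  inferInstanceAs (TopologicalSpace {p : Matrix (Fin (d + 1)) (Fin (d + 1)) 𝔽 //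
    p.IsHermitian ∧ p * p = p ∧ p.trace = 1})

instance [TopologicalSpace 𝔽] : MeasurableSpace (ProjSpace 𝔽 d) := borel _

instance [TopologicalSpace 𝔽] : BorelSpace (ProjSpace 𝔽 d) := ⟨rfl⟩

/-- The geodesic distance, normalized so that the diameter is `π`:
`cos ϑ(p, q) = 2 ⟨p, q⟩ - 1`, where `⟨p, q⟩ = Re tr (p q*) = Re tr (p q)`. If `p = x x*` and
`q = y y*` with unit vectors `x, y` then `⟨p, q⟩ = |x · y|²` (see `inner_line_real`,
`inner_line_complex`, `inner_line_quaternion` below). -/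
def geodesicDist [Inner ℝ 𝔽] (p q : ProjSpace 𝔽 d) : ℝ :=
  Real.arccos (2 * ∑ i, ∑ j, inner ℝ (p.1 i j) (q.1 i j) - 1)

end ProjectiveSpace

/-! ### Geodesic Riesz energy -/

/-- The geodesic Riesz kernel `F_s(t) = (1 / s) (arccos t)^(-s)` on `[-1, 1]`, for `s < 0`
(where it is finite and continuous). -/
def rieszKernel (s t : ℝ) : ℝ := (1 / s) * Real.arccos t ^ (-s)

section Energy

open MeasureTheory

variable {𝔽 : Type} [NonAssocRing 𝔽] [Star 𝔽] [TopologicalSpace 𝔽] {d : ℕ}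

/-- The energy `I_{F_s}(μ) = ∬ F_s(cos ϑ(x, y)) dμ(x) dμ(y)`. -/
def rieszEnergy [Inner ℝ 𝔽] (s : ℝ) (μ : ProbabilityMeasure (ProjSpace 𝔽 d)) : ℝ :=
  ∫ x, ∫ y, rieszKernel s (Real.cos (geodesicDist x y)) ∂(μ : Measure (ProjSpace 𝔽 d))
    ∂(μ : Measure (ProjSpace 𝔽 d))

/-- `μ` minimizes `I_{F_s}` among all Borel probability measures. -/
def IsRieszMinimizer [Inner ℝ 𝔽] (s : ℝ) (μ : ProbabilityMeasure (ProjSpace 𝔽 d)) : Prop :=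
  ∀ ν : ProbabilityMeasure (ProjSpace 𝔽 d), rieszEnergy s μ ≤ rieszEnergy s ν

/-- `μ` is of the form `μ_ONB = (1 / (d + 1)) ∑ δ_{e_j}`, where `e_0, …, e_d` are `d + 1` points
of `𝔽P^d` which are pairwise a diameter `π` apart. -/
def IsONBMeasure [Inner ℝ 𝔽] (μ : ProbabilityMeasure (ProjSpace 𝔽 d)) : Prop :=
  ∃ e : Fin (d + 1) → ProjSpace 𝔽 d, (∀ i j, i ≠ j → geodesicDist (e i) (e j) = Real.pi) ∧
    (μ : Measure (ProjSpace 𝔽 d)) = ((d : ENNReal) + 1)⁻¹ • ∑ j, Measure.dirac (e j)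

end Energy

/-- `t` separates the exponents `s < t`, for which `I_{F_s}` on `𝔽P^d` has minimizers and they are
exactly the measures `μ_ONB`, from the exponents `t < s < 0`, for which no `μ_ONB` is a minimizer. -/
def IsONBThreshold (𝔽 : Type) [NonAssocRing 𝔽] [Star 𝔽] [TopologicalSpace 𝔽] [Inner ℝ 𝔽] (d : ℕ)
    (t : ℝ) : Prop :=
  (∀ s < t, (∃ μ : MeasureTheory.ProbabilityMeasure (ProjSpace 𝔽 d), IsRieszMinimizer s μ) ∧
    ∀ μ : MeasureTheory.ProbabilityMeasure (ProjSpace 𝔽 d),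
      IsRieszMinimizer s μ ↔ IsONBMeasure μ) ∧
  (∀ s, t < s → s < 0 → ∀ μ : MeasureTheory.ProbabilityMeasure (ProjSpace 𝔽 d),
    IsONBMeasure μ → ¬ IsRieszMinimizer s μ)

/-! ### The points of the projective space as lines, for associative scalars -/

section Lines

theorem inner_line {𝔽 : Type} [NormedDivisionRing 𝔽] [StarRing 𝔽] {d : ℕ} [Inner ℝ 𝔽]
    (re : 𝔽 →+ ℝ) (h₁ : ∀ a b, re (a * b) = re (b * a))
    (h₂ : ∀ a b : 𝔽, inner ℝ a b = re (a * star b)) (h₃ : ∀ a : 𝔽, re (a * star a) = ‖a‖ ^ 2)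
    (x y : Fin (d + 1) → 𝔽) :
    ∑ i, ∑ j, inner ℝ (x i * star (x j)) (y i * star (y j)) = ‖∑ i, star (x i) * y i‖ ^ 2 := by
  rw [← h₃, star_sum, Finset.mul_sum, map_sum]
  refine Finset.sum_congr rfl fun i _ => ?_
  rw [Finset.sum_mul, map_sum]
  refine Finset.sum_congr rfl fun j _ => ?_
  rw [h₂, star_mul, star_mul, star_star, star_star,
    h₁ (star (x j) * y j), mul_assoc (star (y i)), h₁ (star (y i))]
  noncomm_ring

variable {𝔽 : Type} [NormedDivisionRing 𝔽] [NormedAlgebra ℝ 𝔽] [StarRing 𝔽] {d : ℕ}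

theorem exists_line (h₂ : ∀ a : 𝔽, a * star a = algebraMap ℝ 𝔽 (‖a‖ ^ 2))
    (h₃ : ∀ r : ℝ, star (algebraMap ℝ 𝔽 r) = algebraMap ℝ 𝔽 r)
    (h₅ : ∀ a : 𝔽, ‖star a‖ = ‖a‖) (p : Matrix (Fin (d + 1)) (Fin (d + 1)) 𝔽)
    (hH : p.IsHermitian) (hp : p * p = p) (ht : p.trace = 1) :
    ∃ x : Fin (d + 1) → 𝔽, ∑ i, ‖x i‖ ^ 2 = 1 ∧ p = Matrix.of fun i j => x i * star (x j) := by
  set N : 𝔽 → ℝ := fun a => ‖a‖ ^ 2 with hN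
  have h₀ : ∀ a, 0 ≤ N a := fun a => sq_nonneg _
  have h₁ : ∀ a, N a = 0 → a = 0 := fun a ha => by simpa [hN] using ha
  have h₄ : Function.Injective (algebraMap ℝ 𝔽) := (algebraMap ℝ 𝔽).injective
  have h₅ : ∀ a, N (star a) = N a := fun a => by simp only [hN, h₅]
  have hs : ∀ i j, star (p i j) = p j i := fun i j => hH.apply j i
  have hdiag : ∀ (q : Matrix (Fin (d + 1)) (Fin (d + 1)) 𝔽), (∀ i j, star (q i j) = q j i) →
      q * q = q → ∀ i, q i i = algebraMap ℝ 𝔽 (∑ j, N (q i j)) := by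
    intro q hq hqq i
    conv_lhs => rw [← hqq, Matrix.mul_apply]
    rw [map_sum]
    refine Finset.sum_congr rfl fun j _ => ?_
    rw [← h₂, hq]
  have hk : ∃ k, ∑ j, N (p k j) ≠ 0 := by
    by_contra! h
    have h' : p.trace = 0 := by
      simp only [Matrix.trace, Matrix.diag]
      refine Finset.sum_eq_zero fun i _ => ?_
      rw [hdiag p hs hp, h i, map_zero]
    rw [h'] at ht
    have := h₄ (a₁ := 0) (a₂ := 1) (by rw [map_zero, map_one, ht])
    exact zero_ne_one this
  obtain ⟨k, hk⟩ := hk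
  set c : ℝ := ∑ j, N (p k j) with hc
  have hc0 : 0 < c := lt_of_le_of_ne (Finset.sum_nonneg fun j _ => h₀ _) (Ne.symm hk)
  have hkk : p k k = algebraMap ℝ 𝔽 c := hdiag p hs hp k
  set r : ℝ := (Real.sqrt c)⁻¹ with hr
  have hrr : r * r * c = 1 := by
    have : Real.sqrt c * Real.sqrt c = c := Real.mul_self_sqrt hc0.le
    have h0 : Real.sqrt c ≠ 0 := (Real.sqrt_pos.2 hc0).ne'
    rw [hr]; field_simp; nlinarith
  set x : Fin (d + 1) → 𝔽 := fun i => p i k * algebraMap ℝ 𝔽 r with hx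
  have hxx : ∀ i j, x i * star (x j) = algebraMap ℝ 𝔽 (r * r) * (p i k * p k j) := by
    intro i j
    simp only [hx, star_mul, h₃, hs, map_mul]
    rw [← Algebra.commutes r (p i k), mul_assoc, ← mul_assoc (p i k), ← Algebra.commutes r (p i k)]
    noncomm_ring
  set u : Matrix (Fin (d + 1)) (Fin (d + 1)) 𝔽 := Matrix.of fun i j => x i * star (x j) with hu
  have hu' : ∀ i j, u i j = algebraMap ℝ 𝔽 (r * r) * (p i k * p k j) := hxx
  have hpe : ∀ i j, ∑ l, p i l * p l j = p i j := fun i j => by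
    rw [← Matrix.mul_apply, hp]
  have e₁ : p * u = u := by
    ext i j
    rw [Matrix.mul_apply, hu']
    conv_rhs => rw [← hpe i k, Finset.sum_mul, Finset.mul_sum]
    refine Finset.sum_congr rfl fun l _ => ?_
    rw [hu', ← mul_assoc, ← Algebra.commutes, mul_assoc, mul_assoc (p i l)]
  have e₂ : u * p = u := by
    ext i j
    rw [Matrix.mul_apply, hu']
    conv_rhs => rw [← hpe k j, Finset.mul_sum, Finset.mul_sum]
    refine Finset.sum_congr rfl fun l _ => ?_
    rw [hu']; noncomm_ring
  have e₃ : u * u = u := by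
    ext i j
    rw [Matrix.mul_apply]
    have : ∀ l, u i l * u l j =
        algebraMap ℝ 𝔽 (r * r) * (algebraMap ℝ 𝔽 (r * r) * (p i k * (p k l * p l k) * p k j)) := by
      intro l
      rw [hu', hu', mul_assoc, ← mul_assoc (p i k * p k l), ← Algebra.commutes _ (p i k * p k l)]
      noncomm_ring
    simp only [this, ← Finset.mul_sum, ← Finset.sum_mul]
    rw [hpe, hkk, hu', ← Algebra.commutes c (p i k), mul_assoc (algebraMap ℝ 𝔽 c),
      ← mul_assoc (algebraMap ℝ 𝔽 (r * r)) (algebraMap ℝ 𝔽 c), ← map_mul, hrr, map_one, one_mul]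
  have hut : u.trace = 1 := by
    have : ∀ l, u l l = algebraMap ℝ 𝔽 (r * r * N (p k l)) := by
      intro l
      have h5 : p l k * p k l = algebraMap ℝ 𝔽 (N (p l k)) := by rw [← h₂, hs]
      have h6 : N (p l k) = N (p k l) := by rw [← hs k l, h₅]
      rw [hu', h5, h6, ← map_mul]
    simp only [Matrix.trace, Matrix.diag, this]
    rw [← map_sum, ← Finset.mul_sum, ← hc, hrr, map_one]
  refine ⟨x, h₄ ?_, Matrix.ext fun i j => ?_⟩
  · rw [map_one, ← hut, map_sum]
    exact Finset.sum_congr rfl fun i _ => (h₂ _).symm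
  have hq : (p - u) * (p - u) = p - u := by
    rw [sub_mul, mul_sub, mul_sub, hp, e₁, e₂, e₃]; abel
  have hqs : ∀ i j, star ((p - u) i j) = (p - u) j i := by
    intro i j
    simp [hu, hs]
  have hqt : ∑ i, ∑ j, N ((p - u) i j) = 0 := by
    apply h₄
    rw [map_sum, map_zero]
    have : (p - u).trace = 0 := by rw [Matrix.trace_sub, ht, hut, sub_self]
    rw [← this]
    exact Finset.sum_congr rfl fun i _ => (hdiag _ hqs hq i).symm
  have h7 := (Finset.sum_eq_zero_iff_of_nonneg
    (fun i _ => Finset.sum_nonneg fun j _ => h₀ _)).1 hqt i (Finset.mem_univ _)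
  have h8 := (Finset.sum_eq_zero_iff_of_nonneg (fun j _ => h₀ _)).1 h7 j (Finset.mem_univ _)
  have h9 := h₁ _ h8
  rw [Matrix.sub_apply, sub_eq_zero] at h9
  exact h9

theorem line_mem (h₂ : ∀ a : 𝔽, a * star a = algebraMap ℝ 𝔽 (‖a‖ ^ 2))
    (h₅ : ∀ a : 𝔽, ‖star a‖ = ‖a‖) (x : Fin (d + 1) → 𝔽) (hx : ∑ i, ‖x i‖ ^ 2 = 1)
    (p : Matrix (Fin (d + 1)) (Fin (d + 1)) 𝔽) (hp : p = Matrix.of fun i j => x i * star (x j)) :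
    p.IsHermitian ∧ p * p = p ∧ p.trace = 1 := by
  subst hp
  refine ⟨?_, ?_, ?_⟩
  · ext i j
    simp
  · ext i j
    have hl : ∀ l, star (x l) * x l = algebraMap ℝ 𝔽 (‖x l‖ ^ 2) := fun l => by
      have := h₂ (star (x l))
      rwa [star_star, h₅] at this
    have : ∀ l, x i * star (x l) * (x l * star (x j)) =
        x i * (algebraMap ℝ 𝔽 (‖x l‖ ^ 2) * star (x j)) := fun l => by
      rw [← hl]; noncomm_ring
    simp only [Matrix.mul_apply, Matrix.of_apply, this]
    rw [← Finset.mul_sum, ← Finset.sum_mul, ← map_sum, hx, map_one, one_mul]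
  · simp only [Matrix.trace, Matrix.diag, Matrix.of_apply, h₂]
    rw [← map_sum, hx, map_one]

/-- Points of `ℝP^d` are the projections `x x*` onto lines. -/
theorem real_iff_line (p : Matrix (Fin (d + 1)) (Fin (d + 1)) ℝ) :
    (p.IsHermitian ∧ p * p = p ∧ p.trace = 1) ↔
      ∃ x : Fin (d + 1) → ℝ, ∑ i, ‖x i‖ ^ 2 = 1 ∧ p = Matrix.of fun i j => x i * star (x j) := by
  have h₂ : ∀ a : ℝ, a * star a = algebraMap ℝ ℝ (‖a‖ ^ 2) := fun a => by simp [sq]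
  exact ⟨fun ⟨h, h', h''⟩ => exists_line h₂ (fun r => by simp) (fun a => by simp) p h h' h'',
    fun ⟨x, hx, hp⟩ => line_mem h₂ (fun a => by simp) x hx p hp⟩

/-- Points of `ℂP^d` are the projections `x x*` onto lines. -/
theorem complex_iff_line (p : Matrix (Fin (d + 1)) (Fin (d + 1)) ℂ) :
    (p.IsHermitian ∧ p * p = p ∧ p.trace = 1) ↔
      ∃ x : Fin (d + 1) → ℂ, ∑ i, ‖x i‖ ^ 2 = 1 ∧ p = Matrix.of fun i j => x i * star (x j) := by
  have h₂ : ∀ a : ℂ, a * star a = algebraMap ℝ ℂ (‖a‖ ^ 2) := fun a => by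
    simpa using Complex.mul_conj' a
  exact ⟨fun ⟨h, h', h''⟩ => exists_line h₂ (fun r => by simp) (fun a => by simp) p h h' h'',
    fun ⟨x, hx, hp⟩ => line_mem h₂ (fun a => by simp) x hx p hp⟩

/-- Points of `ℍP^d` are the projections `x x*` onto lines. -/
theorem quaternion_iff_line (p : Matrix (Fin (d + 1)) (Fin (d + 1)) ℍ) :
    (p.IsHermitian ∧ p * p = p ∧ p.trace = 1) ↔
      ∃ x : Fin (d + 1) → ℍ, ∑ i, ‖x i‖ ^ 2 = 1 ∧ p = Matrix.of fun i j => x i * star (x j) := by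
  have h₂ : ∀ a : ℍ, a * star a = algebraMap ℝ ℍ (‖a‖ ^ 2) := fun a => by
    rw [Quaternion.self_mul_star, Quaternion.normSq_eq_norm_mul_self, sq]; rfl
  exact ⟨fun ⟨h, h', h''⟩ => exists_line h₂ (fun r => Quaternion.star_coe r)
      Quaternion.norm_star p h h' h'',
    fun ⟨x, hx, hp⟩ => line_mem h₂ Quaternion.norm_star x hx p hp⟩

theorem inner_line_real (x y : Fin (d + 1) → ℝ) :
    ∑ i, ∑ j, inner ℝ (x i * star (x j)) (y i * star (y j)) = ‖∑ i, star (x i) * y i‖ ^ 2 :=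
  inner_line (AddMonoidHom.id ℝ) (fun a b => mul_comm a b) (fun a b => by simp [mul_comm])
    (fun a => by simp [sq]) x y

theorem inner_line_complex (x y : Fin (d + 1) → ℂ) :
    ∑ i, ∑ j, inner ℝ (x i * star (x j)) (y i * star (y j)) = ‖∑ i, star (x i) * y i‖ ^ 2 :=
  inner_line Complex.reAddGroupHom (fun a b => by rw [mul_comm])
    (fun a b => by simp [Complex.inner, mul_comm])
    (fun a => by simp [← Complex.normSq_eq_norm_sq, Complex.normSq_apply]) x y

theorem inner_line_quaternion (x y : Fin (d + 1) → ℍ) :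
    ∑ i, ∑ j, inner ℝ (x i * star (x j)) (y i * star (y j)) = ‖∑ i, star (x i) * y i‖ ^ 2 :=
  inner_line ⟨⟨fun a : ℍ => a.re, rfl⟩, fun _ _ => rfl⟩ (fun a b => by
      change (a * b).re = (b * a).re
      rw [Quaternion.re_mul, Quaternion.re_mul]; ring)
    (fun a b => rfl)
    (fun a => by
      rw [Quaternion.self_mul_star, Quaternion.normSq_eq_norm_mul_self, sq]; rfl) x y

end Lines

end

open scoped Quaternion

open MeasureTheory

set_option linter.unusedSectionVars false

/-! Put `ρ = ϑ / π ∈ [0, 1]` and `E_p(μ) = ∬ ρ ^ p dμ dμ`. With `p = -s > 0`, the Riesz energy is a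
negative multiple of `E_p`, so minimizers become maximizers of `E_p`. Put also `n = d + 1`.

Since `ρ ≤ 1`, `E_p(μ)` is nonincreasing in `p`, whereas a frame measure sees only `ρ ∈ {0, 1}` and
has `E_p = 1 - 1/n` for every `p`. The exponents at which frames are optimal therefore form an
upward closed set `P`, and `s* = -inf P`.

`2 ∈ P` (`angleEnergy_two_le`): Jordan's inequality gives `ρ² ≤ 1 - ⟨p, q⟩`, and the double integral
of `⟨p, q⟩` is the squared norm of the barycentre. This is at least `1/n`, because the barycentre
has trace one and the identity matrix has squared norm `n`.

No `p < 1` lies in `P` (`exists_lt_angleEnergy`): an equal mixture of two frames that differ by a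
rotation in one projective line has larger energy.

Rigidity (`isFrameMeasure_of_le`): let `p ∈ P`, `q > p`, and let `μ` maximize `E_q`. Then `E_p(μ) =
E_q(μ)`, which forces `ρ ∈ {0, 1}` on pairs of support points. So the support has at most `n`
points, and the energy value makes all weights `1/n`.

The geometry enters only through an embedding into a Euclidean unit sphere inside the hyperplane of
trace one. This needs `Re (a a*) = |a|²` but no associativity, so the octonions are covered by the
same argument. -/

namespace AngleEnergy

/-! ### Distance ratio and the geometry of trace-one embeddings -/

section

variable {X V : Type*} [NormedAddCommGroup V] [InnerProductSpace ℝ V]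

/-- The distance `arccos (2 ⟪φ x, φ y⟫ - 1)`, normalized to diameter one. -/
noncomputable def angleRatio (φ : X → V) (x y : X) : ℝ :=
  Real.arccos (2 * inner ℝ (φ x) (φ y) - 1) / Real.pi

theorem angleRatio_nonneg (φ : X → V) (x y : X) : 0 ≤ angleRatio φ x y :=
  div_nonneg (Real.arccos_nonneg _) Real.pi_pos.le

theorem angleRatio_le_one (φ : X → V) (x y : X) : angleRatio φ x y ≤ 1 :=
  div_le_one_of_le₀ (Real.arccos_le_pi _) Real.pi_pos.le

/-- An inequality suffices because `Real.arccos` is constant, equal to `π`, below `-1`. -/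
theorem angleRatio_eq_one_iff (φ : X → V) (x y : X) :
    angleRatio φ x y = 1 ↔ inner ℝ (φ x) (φ y) ≤ 0 := by
  rw [angleRatio, div_eq_one_iff_eq Real.pi_ne_zero, Real.arccos_eq_pi]
  constructor <;> intro h <;> linarith

theorem angleRatio_eq_zero_iff (φ : X → V) (x y : X) :
    angleRatio φ x y = 0 ↔ 1 ≤ inner ℝ (φ x) (φ y) := by
  rw [angleRatio, div_eq_zero_iff, or_iff_left Real.pi_ne_zero, Real.arccos_eq_zero]
  constructor <;> intro h <;> linarith

theorem angleRatio_eq_half {φ : X → V} {x y : X} (h : inner ℝ (φ x) (φ y) = 1 / 2) :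
    angleRatio φ x y = 1 / 2 := by
  have := Real.pi_ne_zero
  rw [angleRatio, h]
  norm_num [Real.arccos_zero]
  field_simp

/-- Jordan's inequality `ϑ / π ≤ sin (ϑ / 2)`, squared. -/
theorem sq_angleRatio_le {φ : X → V} (hφ : ∀ x, ‖φ x‖ = 1) (x y : X) :
    angleRatio φ x y ^ 2 ≤ 1 - inner ℝ (φ x) (φ y) := by
  have h1 : inner ℝ (φ x) (φ y) ≤ 1 := by
    simpa [hφ] using real_inner_le_norm (φ x) (φ y)
  set t := inner ℝ (φ x) (φ y)
  rcases le_or_gt 0 t with h0 | h0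
  · set θ := Real.arccos (2 * t - 1) with hθ
    have hc : Real.cos θ = 2 * t - 1 := Real.cos_arccos (by linarith) (by linarith)
    have hθ0 : 0 ≤ θ := Real.arccos_nonneg _
    have hθ1 : θ ≤ Real.pi := Real.arccos_le_pi _
    have hs := Real.mul_le_sin (x := θ / 2) (by linarith) (by linarith)
    have hs' : angleRatio φ x y = 2 / Real.pi * (θ / 2) := by
      change θ / Real.pi = _
      ring
    have hsq : Real.sin (θ / 2) ^ 2 = 1 - t := by
      have := Real.cos_sq (θ / 2)
      rw [mul_div_cancel₀ θ two_ne_zero, hc] at this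
      rw [Real.sin_sq, this]
      ring
    rw [← hs'] at hs
    rw [← hsq]
    exact pow_le_pow_left₀ (angleRatio_nonneg _ _ _) hs 2
  -- For a negative inner product the right side exceeds one.
  · have := pow_le_one₀ (n := 2) (angleRatio_nonneg φ x y) (angleRatio_le_one φ x y)
    linarith

theorem rpow_le_rpow_of_mem_unitInterval {a p q : ℝ} (h0 : 0 ≤ a) (h1 : a ≤ 1) (hp : 0 < p)
    (hpq : p ≤ q) : a ^ q ≤ a ^ p := by
  rcases h0.eq_or_lt with rfl | h
  · rw [Real.zero_rpow hp.ne', Real.zero_rpow (by linarith)]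
  · exact Real.rpow_le_rpow_of_exponent_ge h h1 hpq

/-- A map into the unit sphere of a Euclidean space, whose image lies in the hyperplane of
elements of trace one, the trace being the inner product with `u`, where `‖u‖² = n`. -/
structure IsTraceEmbedding [TopologicalSpace X] (φ : X → V) (u : V) (n : ℕ) : Prop where
  continuous : Continuous φ
  injective : Function.Injective φ
  norm_eq : ∀ x, ‖φ x‖ = 1
  inner_eq : ∀ x, inner ℝ u (φ x) = 1
  norm_sq : ‖u‖ ^ 2 = n

namespace IsTraceEmbedding

variable [TopologicalSpace X] {φ : X → V} {u : V} {n : ℕ}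

theorem angleRatio_self (h : IsTraceEmbedding φ u n) (x : X) : angleRatio φ x x = 0 := by
  rw [angleRatio_eq_zero_iff, real_inner_self_eq_norm_sq, h.norm_eq]
  norm_num

theorem eq_of_angleRatio_eq_zero (h : IsTraceEmbedding φ u n) {x y : X}
    (hxy : angleRatio φ x y = 0) : x = y := by
  rw [angleRatio_eq_zero_iff] at hxy
  refine h.injective ((inner_eq_one_iff_of_norm_eq_one (𝕜 := ℝ) (h.norm_eq x) (h.norm_eq y)).1
    (le_antisymm ?_ hxy))
  simpa [h.norm_eq] using real_inner_le_norm (φ x) (φ y)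

theorem continuous_angleRatio (h : IsTraceEmbedding φ u n) :
    Continuous fun z : X × X => angleRatio φ z.1 z.2 := by
  unfold angleRatio
  have := h.continuous
  fun_prop

theorem continuous_rpow (h : IsTraceEmbedding φ u n) {p : ℝ} (hp : 0 < p) :
    Continuous fun z : X × X => angleRatio φ z.1 z.2 ^ p :=
  h.continuous_angleRatio.rpow_const fun _ => Or.inr hp.le

/-- Cauchy–Schwarz against `u`. It serves both for sums of points at maximal distance and for
barycentres of measures. -/
theorem one_le_mul_norm_sq (h : IsTraceEmbedding φ u n) {v : V} {c : ℝ} (hv : inner ℝ u v = c) :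
    c ^ 2 ≤ n * ‖v‖ ^ 2 := by
  rw [← h.norm_sq, ← mul_pow, ← hv]
  exact sq_le_sq.2 ((abs_real_inner_le_norm u v).trans (le_abs_self _))

/-- There are at most `n` points at pairwise maximal distance. -/
theorem card_le (h : IsTraceEmbedding φ u n) {T : Finset X}
    (hT : ∀ x ∈ T, ∀ y ∈ T, x ≠ y → angleRatio φ x y = 1) : T.card ≤ n := by
  classical
  -- The sum of the points has trace `|T|`, so `|T|² ≤ n ‖∑ φ x‖²`; nonpositive off-diagonal
  -- products give `‖∑ φ x‖² ≤ |T|`.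
  have h1 := h.one_le_mul_norm_sq (v := ∑ x ∈ T, φ x) (c := T.card) (by
    simp [inner_sum, h.inner_eq])
  have h2 : ‖∑ x ∈ T, φ x‖ ^ 2 ≤ T.card := by
    rw [← real_inner_self_eq_norm_sq, sum_inner, Finset.card_eq_sum_ones]
    push_cast
    refine Finset.sum_le_sum fun x hx => ?_
    rw [inner_sum, ← Finset.add_sum_erase _ _ hx, real_inner_self_eq_norm_sq, h.norm_eq]
    have : ∑ y ∈ T.erase x, inner ℝ (φ x) (φ y) ≤ 0 := Finset.sum_nonpos fun y hy => by
      rw [Finset.mem_erase] at hy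
      exact (angleRatio_eq_one_iff φ x y).1 (hT x hx y hy.2 hy.1.symm)
    linarith
  have h3 : (T.card : ℝ) ^ 2 ≤ n * T.card :=
    h1.trans (mul_le_mul_of_nonneg_left h2 (Nat.cast_nonneg n))
  rcases T.card.eq_zero_or_pos with h0 | h0
  · omega
  · have : (0 : ℝ) < T.card := by exact_mod_cast h0
    have : (T.card : ℝ) ≤ n := by nlinarith
    exact_mod_cast this

end IsTraceEmbedding

end

/-! ### Energies of measures, optimality at exponent two, and rigidity -/

section Measure

variable {X V : Type*} [NormedAddCommGroup V] [InnerProductSpace ℝ V]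
  [TopologicalSpace X] [SecondCountableTopology X] [T1Space X] [MeasurableSpace X] [BorelSpace X]

/-- The mutual energy of the kernel `(ϑ / π) ^ p`. -/
noncomputable def angleEnergy (φ : X → V) (p : ℝ) (μ : ProbabilityMeasure X) : ℝ :=
  ∫ z, angleRatio φ z.1 z.2 ^ p ∂((μ : Measure X).prod (μ : Measure X))

/-- The mean of `n` point masses at pairwise maximal distance. -/
def IsFrameMeasure (φ : X → V) (n : ℕ) (μ : ProbabilityMeasure X) : Prop :=
  ∃ e : Fin n → X, (∀ i j, i ≠ j → angleRatio φ (e i) (e j) = 1) ∧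
    (μ : Measure X) = (n : ENNReal)⁻¹ • ∑ j, Measure.dirac (e j)

theorem integral_sum_smul_dirac {ι : Type*} (s : Finset ι) (c : ι → ENNReal) (hc : ∀ i, c i ≠ ⊤)
    (g : ι → X) (f : X → ℝ) :
    ∫ x, f x ∂(∑ i ∈ s, c i • Measure.dirac (g i)) = ∑ i ∈ s, (c i).toReal * f (g i) := by
  rw [integral_finsetSum_measure fun i _ => (integrable_dirac (by simp)).smul_measure (hc i)]
  simp [integral_smul_measure, integral_dirac]

namespace IsTraceEmbedding

variable {φ : X → V} {u : V} {n : ℕ}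

theorem integrable_rpow (h : IsTraceEmbedding φ u n) {p : ℝ} (hp : 0 < p)
    (μ : ProbabilityMeasure X) :
    Integrable (fun z : X × X => angleRatio φ z.1 z.2 ^ p)
      ((μ : Measure X).prod (μ : Measure X)) := by
  refine Integrable.of_bound (h.continuous_rpow hp).aestronglyMeasurable 1 (.of_forall fun z => ?_)
  rw [Real.norm_of_nonneg (Real.rpow_nonneg (angleRatio_nonneg _ _ _) _)]
  exact Real.rpow_le_one (angleRatio_nonneg _ _ _) (angleRatio_le_one _ _ _) hp.le

theorem angleEnergy_eq (h : IsTraceEmbedding φ u n) {p : ℝ} (hp : 0 < p)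
    (μ : ProbabilityMeasure X) :
    angleEnergy φ p μ = ∫ x, ∫ y, angleRatio φ x y ^ p ∂(μ : Measure X) ∂(μ : Measure X) :=
  integral_prod _ (h.integrable_rpow hp μ)

theorem angleEnergy_anti (h : IsTraceEmbedding φ u n) {p q : ℝ} (hp : 0 < p) (hpq : p ≤ q)
    (μ : ProbabilityMeasure X) : angleEnergy φ q μ ≤ angleEnergy φ p μ :=
  integral_mono (h.integrable_rpow (hp.trans_le hpq) μ) (h.integrable_rpow hp μ) fun _ =>
    rpow_le_rpow_of_mem_unitInterval (angleRatio_nonneg _ _ _) (angleRatio_le_one _ _ _) hp hpq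

theorem angleEnergy_of_eq_sum (h : IsTraceEmbedding φ u n) {p : ℝ} (hp : 0 < p)
    {μ : ProbabilityMeasure X} {ι : Type*} (s : Finset ι) (c : ι → ENNReal) (hc : ∀ i, c i ≠ ⊤)
    (g : ι → X) (hμ : (μ : Measure X) = ∑ i ∈ s, c i • Measure.dirac (g i)) :
    angleEnergy φ p μ =
      ∑ i ∈ s, ∑ j ∈ s, (c i).toReal * (c j).toReal * angleRatio φ (g i) (g j) ^ p := by
  rw [h.angleEnergy_eq hp, hμ, integral_sum_smul_dirac s c hc]
  refine Finset.sum_congr rfl fun i _ => ?_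
  rw [integral_sum_smul_dirac s c hc, Finset.mul_sum]
  exact Finset.sum_congr rfl fun j _ => by ring

end IsTraceEmbedding

/-- The uniform measure on a finite family of points. -/
noncomputable def uniformMeasure {ι : Type*} [Fintype ι] [Nonempty ι] (g : ι → X) :
    ProbabilityMeasure X :=
  ⟨∑ i, (Fintype.card ι : ENNReal)⁻¹ • Measure.dirac (g i), ⟨by
    simp only [Measure.coe_finsetSum, Finset.sum_apply, Measure.smul_apply, measure_univ,
      smul_eq_mul, mul_one, Finset.sum_const, Finset.card_univ, nsmul_eq_mul]
    exact ENNReal.mul_inv_cancel (by simp) (by simp)⟩⟩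

namespace IsTraceEmbedding

variable {φ : X → V} {u : V} {n : ℕ}

theorem angleEnergy_uniformMeasure (h : IsTraceEmbedding φ u n) {p : ℝ} (hp : 0 < p)
    {ι : Type*} [Fintype ι] [Nonempty ι] (g : ι → X) :
    angleEnergy φ p (uniformMeasure g) =
      (∑ i, ∑ j, angleRatio φ (g i) (g j) ^ p) / (Fintype.card ι : ℝ) ^ 2 := by
  rw [h.angleEnergy_of_eq_sum hp Finset.univ (fun _ => (Fintype.card ι : ENNReal)⁻¹)
    (fun _ => by simp) g rfl, Finset.sum_div]
  refine Finset.sum_congr rfl fun i _ => ?_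
  rw [Finset.sum_div]
  refine Finset.sum_congr rfl fun j _ => ?_
  simp only [ENNReal.toReal_inv, ENNReal.toReal_natCast]
  ring

/-- Only the diagonal, of mass `1/n`, fails to contribute one. The value does not depend on `p`. -/
theorem angleEnergy_of_isFrameMeasure (h : IsTraceEmbedding φ u n) {p : ℝ} (hp : 0 < p)
    {μ : ProbabilityMeasure X} (hμ : IsFrameMeasure φ n μ) (hn : n ≠ 0) :
    angleEnergy φ p μ = 1 - 1 / n := by
  obtain ⟨e, he, hμ⟩ := hμ
  have hn' : (n : ℝ) ≠ 0 := by exact_mod_cast hn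
  rw [h.angleEnergy_of_eq_sum hp Finset.univ (fun _ => (n : ENNReal)⁻¹) (fun _ => by simp [hn]) e
    (by rw [hμ, Finset.smul_sum])]
  have : ∀ i j, angleRatio φ (e i) (e j) ^ p = 1 - if i = j then 1 else 0 := fun i j => by
    split_ifs with hij
    · rw [hij, h.angleRatio_self, Real.zero_rpow hp.ne', sub_self]
    · rw [he i j hij, Real.one_rpow, sub_zero]
  simp only [this, ← Finset.mul_sum, Finset.sum_sub_distrib]
  simp
  field_simp

/-- For the square of the distance, the frame measures are optimal. -/
theorem angleEnergy_two_le [CompleteSpace V] (h : IsTraceEmbedding φ u n) (hn : n ≠ 0)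
    (μ : ProbabilityMeasure X) : angleEnergy φ 2 μ ≤ 1 - 1 / n := by
  have hn' : (0 : ℝ) < n := by exact_mod_cast Nat.pos_of_ne_zero hn
  have hi : Integrable φ (μ : Measure X) :=
    Integrable.of_bound h.continuous.aestronglyMeasurable 1 (.of_forall fun x => (h.norm_eq x).le)
  have hc : Continuous fun z : X × X => inner ℝ (φ z.1) (φ z.2) := by
    have := h.continuous
    fun_prop
  have hi2 : Integrable (fun z : X × X => inner ℝ (φ z.1) (φ z.2))
      ((μ : Measure X).prod (μ : Measure X)) := by
    refine Integrable.of_bound hc.aestronglyMeasurable 1 (.of_forall fun z => ?_)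
    simpa [h.norm_eq] using norm_inner_le_norm (𝕜 := ℝ) (φ z.1) (φ z.2)
  set v := ∫ x, φ x ∂(μ : Measure X) with hv
  -- Bilinearity: `v` is the barycentre of the embedded measure.
  have h1 : ∫ z, inner ℝ (φ z.1) (φ z.2) ∂((μ : Measure X).prod (μ : Measure X)) = ‖v‖ ^ 2 := by
    rw [integral_prod _ hi2]
    simp only [integral_inner hi]
    simp only [real_inner_comm v, ← hv]
    rw [integral_inner hi, real_inner_self_eq_norm_sq]
  have h2 := h.one_le_mul_norm_sq (v := v) (c := 1) (by
    rw [hv, ← integral_inner hi]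
    simp [h.inner_eq])
  have h3 : 1 / (n : ℝ) ≤ ‖v‖ ^ 2 := by
    rw [div_le_iff₀ hn']
    linarith
  calc angleEnergy φ 2 μ
      ≤ ∫ z, (1 - inner ℝ (φ z.1) (φ z.2)) ∂((μ : Measure X).prod (μ : Measure X)) := by
        refine integral_mono (h.integrable_rpow two_pos μ) ((integrable_const 1).sub hi2) fun z => ?_
        rw [Real.rpow_two]
        exact sq_angleRatio_le h.norm_eq _ _
    _ = 1 - ‖v‖ ^ 2 := by
        rw [integral_sub (integrable_const 1) hi2, h1]
        simp
    _ ≤ 1 - 1 / n := by linarith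

/-- If the energy does not drop when the exponent is raised, then the points of the support are
at pairwise maximal distance. -/
theorem angleRatio_eq_one_of_mem_support (h : IsTraceEmbedding φ u n) {p q : ℝ} (hp : 0 < p)
    (hpq : p < q) {μ : ProbabilityMeasure X} (hμ : angleEnergy φ p μ ≤ angleEnergy φ q μ)
    {x y : X} (hx : x ∈ (μ : Measure X).support) (hy : y ∈ (μ : Measure X).support)
    (hxy : x ≠ y) : angleRatio φ x y = 1 := by
  -- `G` is continuous, nonnegative and of integral zero, so it vanishes at pairs of support points;
  -- a zero of `G` means `ρ ∈ {0, 1}`.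
  set G : X × X → ℝ := fun z => angleRatio φ z.1 z.2 ^ p - angleRatio φ z.1 z.2 ^ q with hG
  have hq := hp.trans hpq
  have hG0 : 0 ≤ G := fun z => sub_nonneg.2 <|
    rpow_le_rpow_of_mem_unitInterval (angleRatio_nonneg _ _ _) (angleRatio_le_one _ _ _) hp hpq.le
  have hGi : Integrable G ((μ : Measure X).prod (μ : Measure X)) :=
    (h.integrable_rpow hp μ).sub (h.integrable_rpow hq μ)
  have hGc : Continuous G := (h.continuous_rpow hp).sub (h.continuous_rpow hq)
  have hG1 : ∫ z, G z ∂((μ : Measure X).prod (μ : Measure X)) = 0 := by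
    refine le_antisymm ?_ (integral_nonneg hG0)
    rw [hG, integral_sub (h.integrable_rpow hp μ) (h.integrable_rpow hq μ)]
    exact sub_nonpos.2 hμ
  have hae := (integral_eq_zero_iff_of_nonneg hG0 hGi).1 hG1
  have hGxy : G (x, y) = 0 := by
    by_contra hne
    have hmem : {z | G z ≠ 0} ∈ nhds (x, y) := (isOpen_ne_fun hGc continuous_const).mem_nhds hne
    obtain ⟨A, hA, B, hB, hAB⟩ := mem_nhds_prod_iff.1 hmem
    have h0 : ((μ : Measure X).prod (μ : Measure X)) (A ×ˢ B) = 0 :=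
      measure_mono_null hAB (by simpa using ae_iff.1 hae)
    rw [Measure.prod_prod] at h0
    have := (Measure.mem_support_iff_forall x).1 hx A hA
    have := (Measure.mem_support_iff_forall y).1 hy B hB
    rcases mul_eq_zero.1 h0 with h' | h' <;> simp_all
  by_contra hne
  have h0 : 0 < angleRatio φ x y := lt_of_le_of_ne (angleRatio_nonneg _ _ _) fun h' =>
    hxy (h.eq_of_angleRatio_eq_zero h'.symm)
  have h1 : angleRatio φ x y < 1 := lt_of_le_of_ne (angleRatio_le_one _ _ _) hne
  exact (Real.rpow_lt_rpow_of_exponent_gt h0 h1 hpq).ne' (sub_eq_zero.1 hGxy)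

/-- The two bounds and monotonicity in the exponent squeeze both energies to `1 - 1/n`, so the
support is finite with pairwise maximal distances. It remains to find the weights. -/
theorem isFrameMeasure_of_le (h : IsTraceEmbedding φ u n) (hn : n ≠ 0) {p q : ℝ} (hp : 0 < p)
    (hpq : p < q) {μ : ProbabilityMeasure X} (hμp : angleEnergy φ p μ ≤ 1 - 1 / n)
    (hμq : 1 - 1 / n ≤ angleEnergy φ q μ) : IsFrameMeasure φ n μ := by
  classical
  have hn' : (0 : ℝ) < n := by exact_mod_cast Nat.pos_of_ne_zero hn
  set S := (μ : Measure X).support with hS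
  have hS1 : ∀ x ∈ S, ∀ y ∈ S, x ≠ y → angleRatio φ x y = 1 := fun x hx y hy hxy =>
    h.angleRatio_eq_one_of_mem_support hp hpq (hμp.trans hμq) hx hy hxy
  have hfin : S.Finite := by
    by_contra hinf
    obtain ⟨T, hT, hcard⟩ := Set.Infinite.exists_subset_card_eq hinf (n + 1)
    have := h.card_le (T := T) fun x hx y hy => hS1 x (hT hx) y (hT hy)
    omega
  set T := hfin.toFinset with hT
  have hTS : (T : Set X) = S := hfin.coe_toFinset
  have hT1 : ∀ x ∈ T, ∀ y ∈ T, x ≠ y → angleRatio φ x y = 1 := fun x hx y hy =>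
    hS1 x (hfin.mem_toFinset.1 hx) y (hfin.mem_toFinset.1 hy)
  have hTn : T.card ≤ n := h.card_le hT1
  have hTc : (μ : Measure X) (T : Set X)ᶜ = 0 := by
    rw [hTS]
    exact Measure.measure_compl_support
  set c : X → ENNReal := fun x => (μ : Measure X) {x} with hc
  have hsum : (μ : Measure X) = ∑ x ∈ T, c x • Measure.dirac x := by
    ext A hA
    rw [← measure_inter_add_sdiff A T.measurableSet,
      measure_mono_null (Set.sdiff_subset_compl A T) hTc, add_zero]
    have : A ∩ T = ((T.filter (· ∈ A) : Finset X) : Set X) := by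
      ext x
      simp [and_comm]
    rw [this, ← sum_measure_singleton, Finset.sum_filter]
    simp [hc, Measure.dirac_apply' _ hA, Set.indicator_apply]
  have hw : ∑ x ∈ T, (c x).toReal = 1 := by
    rw [← ENNReal.toReal_sum fun x _ => measure_ne_top _ _, sum_measure_singleton,
      (prob_compl_eq_zero_iff T.measurableSet).1 hTc, ENNReal.toReal_one]
  have hE : angleEnergy φ q μ = 1 - ∑ x ∈ T, (c x).toReal ^ 2 := by
    rw [h.angleEnergy_of_eq_sum (hp.trans hpq) T c (fun x => measure_ne_top _ _) id hsum]
    calc _ = ∑ x ∈ T, ∑ y ∈ T, ((c x).toReal * (c y).toReal -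
          if x = y then (c x).toReal * (c y).toReal else 0) := by
          refine Finset.sum_congr rfl fun x hx => Finset.sum_congr rfl fun y hy => ?_
          split_ifs with hxy
          · rw [hxy, id, h.angleRatio_self, Real.zero_rpow (hp.trans hpq).ne', mul_zero, sub_self]
          · rw [id, id, hT1 x hx y hy hxy, Real.one_rpow, mul_one, sub_zero]
      _ = _ := by
          simp only [Finset.sum_sub_distrib, ← Finset.mul_sum, hw, mul_one, sq]
          congr 1
          refine Finset.sum_congr rfl fun x hx => ?_
          simp [hx]
  -- The bound at `q` says `∑ c² ≤ 1/n`. With `∑ c = 1` and `|T| ≤ n`, the sum is at most `1/n - 2/n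
  -- + 1/n`.
  have hvar : ∑ x ∈ T, ((c x).toReal - 1 / n) ^ 2 ≤ 0 := by
    have h1 : ∑ x ∈ T, ((c x).toReal - 1 / n) ^ 2 =
        ∑ x ∈ T, (c x).toReal ^ 2 - 2 * (1 / n) + T.card * (1 / n) ^ 2 := by
      simp only [sub_sq, Finset.sum_add_distrib, Finset.sum_sub_distrib, ← Finset.sum_mul,
        ← Finset.mul_sum, hw]
      simp
    have h2 : (T.card : ℝ) * (1 / n) ^ 2 ≤ 1 / n := by
      have : (T.card : ℝ) ≤ n := by exact_mod_cast hTn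
      calc (T.card : ℝ) * (1 / (n : ℝ)) ^ 2 ≤ n * (1 / (n : ℝ)) ^ 2 := by gcongr
        _ = 1 / (n : ℝ) := by field_simp
    rw [h1]
    linarith
  have hcx : ∀ x ∈ T, (c x).toReal = 1 / n := fun x hx => by
    have := (Finset.sum_eq_zero_iff_of_nonneg fun x _ => sq_nonneg _).1
      (le_antisymm hvar (Finset.sum_nonneg fun x _ => sq_nonneg _)) x hx
    exact sub_eq_zero.1 (pow_eq_zero_iff two_ne_zero |>.1 this)
  have hcard : T.card = n := by
    rw [Finset.sum_congr rfl hcx, Finset.sum_const, nsmul_eq_mul, mul_one_div,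
      div_eq_one_iff_eq hn'.ne'] at hw
    exact_mod_cast hw
  have hcx' : ∀ x ∈ T, c x = (n : ENNReal)⁻¹ := fun x hx => by
    rw [← ENNReal.ofReal_toReal (a := c x) (measure_ne_top _ _), ← ENNReal.ofReal_natCast,
      ← ENNReal.ofReal_inv_of_pos hn', ← one_div]
    exact congrArg _ (hcx x hx)
  let e := T.equivFinOfCardEq hcard
  refine ⟨fun i => (e.symm i : X), fun i j hij => hT1 _ (e.symm i).2 _ (e.symm j).2 fun h' =>
    hij (e.symm.injective (Subtype.ext h')), ?_⟩
  rw [hsum, Finset.smul_sum, Finset.sum_congr rfl fun x hx => by rw [hcx' x hx],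
    ← Finset.sum_coe_sort T fun x => (n : ENNReal)⁻¹ • Measure.dirac x]
  exact (e.symm.sum_comp fun x : T => (n : ENNReal)⁻¹ • Measure.dirac (x : X)).symm

end IsTraceEmbedding

/-! ### Frames are not optimal below exponent one -/

theorem angleRatio_comm (φ : X → V) (x y : X) : angleRatio φ x y = angleRatio φ y x := by
  rw [angleRatio, angleRatio, real_inner_comm]

theorem sum_eq_add_of_two_le {M : Type*} [AddCommMonoid M] {k : ℕ} (G : Fin (k + 2) → M)
    (hG : ∀ i : Fin (k + 2), 2 ≤ (i : ℕ) → G i = 0) : ∑ i, G i = G 0 + G 1 := by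
  rw [Fin.sum_univ_succ, Fin.sum_univ_succ, Finset.sum_eq_zero fun i _ => hG _ (by simp), add_zero]
  rfl

namespace IsTraceEmbedding

variable {φ : X → V} {u : V}

/-- Below exponent one, mixing a frame with a frame rotated by `π / 2` in one projective line
improves the energy. -/
theorem exists_lt_angleEnergy {k : ℕ} (h : IsTraceEmbedding φ u (k + 2)) {p : ℝ} (hp : 0 < p)
    (hp1 : p < 1) {e f : Fin (k + 2) → X} (he : ∀ i j, i ≠ j → angleRatio φ (e i) (e j) = 1)
    (hf : ∀ i j, i ≠ j → angleRatio φ (f i) (f j) = 1)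
    (hef : ∀ i j, angleRatio φ (e i) (f j) =
      if (i : ℕ) < 2 ∧ (j : ℕ) < 2 then 1 / 2 else if i = j then 0 else 1) :
    ∃ μ : ProbabilityMeasure X, 1 - 1 / ((k + 2 : ℕ) : ℝ) < angleEnergy φ p μ := by
  refine ⟨uniformMeasure (Sum.elim e f), ?_⟩
  set a : ℝ := (1 / 2) ^ p with ha
  have ha2 : 1 / 2 < a := by
    have := Real.rpow_lt_rpow_of_exponent_gt (x := 1 / 2) (by norm_num) (by norm_num) hp1
    rwa [Real.rpow_one] at this
  set N : ℝ := ((k + 2 : ℕ) : ℝ) with hN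
  have hN0 : 0 < N := by positivity
  have hsum : ∑ i : Fin (k + 2), ∑ j : Fin (k + 2), ((1 : ℝ) - if i = j then 1 else 0) =
      N ^ 2 - N := by
    simp [Finset.sum_sub_distrib, hN]
    ring
  have hframe : ∀ g : Fin (k + 2) → X, (∀ i j, i ≠ j → angleRatio φ (g i) (g j) = 1) →
      ∑ i, ∑ j, angleRatio φ (g i) (g j) ^ p = N ^ 2 - N := fun g hg => by
    rw [← hsum]
    refine Finset.sum_congr rfl fun i _ => Finset.sum_congr rfl fun j _ => ?_
    split_ifs with hij
    · rw [hij, h.angleRatio_self, Real.zero_rpow hp.ne', sub_self]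
    · rw [hg i j hij, Real.one_rpow, sub_zero]
  -- Compared with a single frame, the leading 2 × 2 block has four entries `a` in place of two
  -- zeros and two ones. The gain `4 a - 2` is positive because `p < 1`.
  have hcross : ∑ i, ∑ j, angleRatio φ (e i) (f j) ^ p = N ^ 2 - N + (4 * a - 2) := by
    have hblock : ∑ i : Fin (k + 2), ∑ j : Fin (k + 2),
        (if (i : ℕ) < 2 ∧ (j : ℕ) < 2 then a - 1 + if i = j then 1 else 0 else 0) = 4 * a - 2 := by
      rw [sum_eq_add_of_two_le _ fun i hi => Finset.sum_eq_zero fun j _ => if_neg (by omega),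
        sum_eq_add_of_two_le _ fun j hj => if_neg (by omega),
        sum_eq_add_of_two_le _ fun j hj => if_neg (by omega)]
      simp
      ring
    rw [← hsum, ← hblock, ← Finset.sum_add_distrib]
    refine Finset.sum_congr rfl fun i _ => ?_
    rw [← Finset.sum_add_distrib]
    refine Finset.sum_congr rfl fun j _ => ?_
    rw [hef]
    split_ifs
    · rw [← ha]; ring
    · rw [← ha]; ring
    · rw [Real.zero_rpow hp.ne']; ring
    · rw [Real.one_rpow]; ring
  have hcross' : ∑ i, ∑ j, angleRatio φ (f i) (e j) ^ p = N ^ 2 - N + (4 * a - 2) := by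
    rw [← hcross, Finset.sum_comm]
    simp only [angleRatio_comm φ (f _) (e _)]
  have hcard : (Fintype.card (Fin (k + 2) ⊕ Fin (k + 2)) : ℝ) = N + N := by simp [hN]
  rw [h.angleEnergy_uniformMeasure hp, hcard]
  simp only [Fintype.sum_sum_type, Sum.elim_inl, Sum.elim_inr, Finset.sum_add_distrib,
    hframe e he, hframe f hf, hcross, hcross']
  rw [lt_div_iff₀ (by positivity)]
  have : (1 - 1 / N) * (N + N) ^ 2 = 4 * (N ^ 2 - N) := by
    field_simp
    ring
  rw [this]
  linarith

end IsTraceEmbedding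

end Measure

end AngleEnergy

open AngleEnergy

/-! ### From the angle energy to the Riesz energy and its threshold -/

section ProjSpace

variable {𝔽 : Type} [NonAssocRing 𝔽] [StarRing 𝔽] [TopologicalSpace 𝔽] [Inner ℝ 𝔽]
  {V : Type*} [NormedAddCommGroup V] [InnerProductSpace ℝ V] {d : ℕ}

namespace ProjSpace

theorem geodesicDist_eq {φ : ProjSpace 𝔽 d → V}
    (hφ : ∀ p q, ∑ i, ∑ j, inner ℝ (p.1 i j) (q.1 i j) = inner ℝ (φ p) (φ q))
    (p q : ProjSpace 𝔽 d) : geodesicDist p q = Real.pi * angleRatio φ p q := by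
  rw [geodesicDist, hφ, angleRatio, mul_div_cancel₀ _ Real.pi_ne_zero]

variable [SecondCountableTopology (ProjSpace 𝔽 d)] [T1Space (ProjSpace 𝔽 d)]

theorem rieszEnergy_eq {φ : ProjSpace 𝔽 d → V} {u : V} {n : ℕ} (h : IsTraceEmbedding φ u n)
    (hφ : ∀ p q, ∑ i, ∑ j, inner ℝ (p.1 i j) (q.1 i j) = inner ℝ (φ p) (φ q))
    {s : ℝ} (hs : s < 0) (μ : ProbabilityMeasure (ProjSpace 𝔽 d)) :
    rieszEnergy s μ = (1 / s * Real.pi ^ (-s)) * angleEnergy φ (-s) μ := by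
  rw [h.angleEnergy_eq (by linarith), rieszEnergy, ← integral_const_mul]
  refine integral_congr_ae (.of_forall fun x => ?_)
  simp only [← integral_const_mul]
  refine integral_congr_ae (.of_forall fun y => ?_)
  have h0 := angleRatio_nonneg φ x y
  simp only [rieszKernel]
  rw [geodesicDist_eq hφ, Real.arccos_cos (mul_nonneg Real.pi_pos.le h0)
    (mul_le_of_le_one_right Real.pi_pos.le (angleRatio_le_one _ _ _)),
    Real.mul_rpow Real.pi_pos.le h0, mul_assoc]

/-- The factor `1 / s` is negative, which reverses the inequality. -/
theorem isRieszMinimizer_iff {φ : ProjSpace 𝔽 d → V} {u : V} {n : ℕ} (h : IsTraceEmbedding φ u n)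
    (hφ : ∀ p q, ∑ i, ∑ j, inner ℝ (p.1 i j) (q.1 i j) = inner ℝ (φ p) (φ q))
    {s : ℝ} (hs : s < 0) (μ : ProbabilityMeasure (ProjSpace 𝔽 d)) :
    IsRieszMinimizer s μ ↔
      ∀ ν : ProbabilityMeasure (ProjSpace 𝔽 d), angleEnergy φ (-s) ν ≤ angleEnergy φ (-s) μ := by
  refine forall_congr' fun ν => ?_
  rw [rieszEnergy_eq h hφ hs, rieszEnergy_eq h hφ hs]
  exact mul_le_mul_left_of_neg
    (mul_neg_of_neg_of_pos (one_div_neg.2 hs) (Real.rpow_pos_of_pos Real.pi_pos _))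

theorem isONBMeasure_iff {φ : ProjSpace 𝔽 d → V}
    (hφ : ∀ p q, ∑ i, ∑ j, inner ℝ (p.1 i j) (q.1 i j) = inner ℝ (φ p) (φ q))
    (μ : ProbabilityMeasure (ProjSpace 𝔽 d)) : IsONBMeasure μ ↔ IsFrameMeasure φ (d + 1) μ := by
  simp only [IsONBMeasure, IsFrameMeasure, geodesicDist_eq hφ, mul_eq_left₀ Real.pi_ne_zero,
    Nat.cast_add, Nat.cast_one]

theorem existsUnique_isONBThreshold [CompleteSpace V] {k : ℕ}
    [SecondCountableTopology (ProjSpace 𝔽 (k + 1))] [T1Space (ProjSpace 𝔽 (k + 1))]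
    {φ : ProjSpace 𝔽 (k + 1) → V} {u : V}
    (h : IsTraceEmbedding φ u (k + 2))
    (hφ : ∀ p q, ∑ i, ∑ j, inner ℝ (p.1 i j) (q.1 i j) = inner ℝ (φ p) (φ q))
    {e f : Fin (k + 2) → ProjSpace 𝔽 (k + 1)}
    (he : ∀ i j, i ≠ j → angleRatio φ (e i) (e j) = 1)
    (hf : ∀ i j, i ≠ j → angleRatio φ (f i) (f j) = 1)
    (hef : ∀ i j, angleRatio φ (e i) (f j) =
      if (i : ℕ) < 2 ∧ (j : ℕ) < 2 then 1 / 2 else if i = j then 0 else 1) :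
    ∃! t : ℝ, t ∈ Set.Icc (-2 : ℝ) (-1) ∧ IsONBThreshold 𝔽 (k + 1) t := by
  have hn : k + 2 ≠ 0 := by omega
  set m : ℝ := 1 - 1 / ((k + 2 : ℕ) : ℝ) with hm
  set P : Set ℝ := {p | 0 < p ∧
    ∀ ν : ProbabilityMeasure (ProjSpace 𝔽 (k + 1)), angleEnergy φ p ν ≤ m} with hP
  have h2 : (2 : ℝ) ∈ P := ⟨two_pos, h.angleEnergy_two_le hn⟩
  have h1 : ∀ p ∈ P, 1 ≤ p := fun p hp => by
    by_contra hlt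
    obtain ⟨μ, hμ⟩ := h.exists_lt_angleEnergy hp.1 (not_le.1 hlt) he hf hef
    exact absurd (hp.2 μ) (not_le.2 hμ)
  have hbdd : BddBelow P := ⟨1, h1⟩
  set μ₀ : ProbabilityMeasure (ProjSpace 𝔽 (k + 1)) := uniformMeasure e with hμ₀
  have hμ₀' : IsFrameMeasure φ (k + 2) μ₀ := ⟨e, he, by
    rw [Finset.smul_sum]
    change ∑ i, (Fintype.card (Fin (k + 2)) : ENNReal)⁻¹ • Measure.dirac (e i) = _
    simp only [Fintype.card_fin]⟩
  have hmin : ∀ s < -sInf P, ∀ μ : ProbabilityMeasure (ProjSpace 𝔽 (k + 1)),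
      IsRieszMinimizer s μ ↔ IsONBMeasure μ := fun s hs μ => by
    -- An optimal exponent strictly below `-s`: the strict gap is what rigidity needs, and it avoids
    -- deciding whether `inf P` belongs to `P`.
    obtain ⟨p, hp, hps⟩ := exists_lt_of_csInf_lt ⟨2, h2⟩ (lt_neg_of_lt_neg hs)
    have hs0 : s < 0 := by linarith [hp.1]
    rw [isRieszMinimizer_iff h hφ hs0, isONBMeasure_iff hφ]
    constructor
    · intro hμ
      refine h.isFrameMeasure_of_le hn hp.1 hps (hp.2 μ) ?_
      rw [← h.angleEnergy_of_isFrameMeasure (p := -s) (by linarith) hμ₀' hn]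
      exact hμ μ₀
    · intro hμ ν
      rw [h.angleEnergy_of_isFrameMeasure (by linarith) hμ hn]
      exact (h.angleEnergy_anti hp.1 hps.le ν).trans (hp.2 ν)
  have hthr : IsONBThreshold 𝔽 (k + 1) (-sInf P) := by
    refine ⟨fun s hs => ⟨⟨μ₀, (hmin s hs μ₀).2 ((isONBMeasure_iff hφ μ₀).2 hμ₀')⟩, hmin s hs⟩,
      fun s hs hs0 μ hμ hμ' => ?_⟩
    rw [isRieszMinimizer_iff h hφ hs0,
      h.angleEnergy_of_isFrameMeasure (by linarith) ((isONBMeasure_iff hφ μ).1 hμ) hn] at hμ'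
    have := csInf_le hbdd (show -s ∈ P from ⟨by linarith, hμ'⟩)
    linarith
  -- At the midpoint of two thresholds a frame measure would both be and not be a minimizer; `t' ≤
  -- -1` keeps the midpoint negative.
  have huniq : ∀ t t' : ℝ, t < t' → t' ≤ -1 → IsONBThreshold 𝔽 (k + 1) t →
      ¬ IsONBThreshold 𝔽 (k + 1) t' := fun t t' htt ht' ht ht2 => by
    have hONB := (isONBMeasure_iff hφ μ₀).2 hμ₀'
    exact ht.2 ((t + t') / 2) (by linarith) (by linarith) μ₀ hONB
      (((ht2.1 ((t + t') / 2) (by linarith)).2 μ₀).2 hONB)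
  refine ⟨-sInf P, ⟨⟨?_, ?_⟩, hthr⟩, fun t ⟨ht, ht'⟩ => ?_⟩
  · exact neg_le_neg (csInf_le hbdd h2)
  · exact neg_le_neg (le_csInf ⟨2, h2⟩ h1)
  · rcases lt_trichotomy t (-sInf P) with hlt | heq | hgt
    · exact absurd hthr (huniq _ _ hlt (neg_le_neg (le_csInf ⟨2, h2⟩ h1)) ht')
    · exact heq
    · exact absurd ht' (huniq _ _ hgt ht.2 hthr)

end ProjSpace

end ProjSpace

/-! ### Euclidean coordinates of projective space and explicit frames -/

section ScalarEmbedding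

variable {𝔽 : Type} [NonAssocRing 𝔽] [StarRing 𝔽] [TopologicalSpace 𝔽] [Inner ℝ 𝔽]
  {W : Type*} [NormedAddCommGroup W] [InnerProductSpace ℝ W] {d : ℕ}

/-- A realization of the inner product of a possibly nonassociative `*`-ring in a Euclidean space,
such that `Re (a a*) = |a|²`, the real part being the inner product with `1`. -/
structure IsScalarEmbedding (ι : 𝔽 →+ W) : Prop where
  continuous : Continuous ι
  injective : Function.Injective ι
  inner_eq : ∀ a b, inner ℝ a b = inner ℝ (ι a) (ι b)
  norm_one : ‖ι 1‖ = 1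
  inner_mul_star : ∀ a, inner ℝ (ι 1) (ι (a * star a)) = ‖ι a‖ ^ 2

namespace ProjSpace

/-- The entries of a point, as a vector of a Euclidean space. -/
noncomputable def toVec (ι : 𝔽 →+ W) (p : ProjSpace 𝔽 d) :
    PiLp 2 fun _ : Fin (d + 1) × Fin (d + 1) => W :=
  WithLp.toLp 2 fun ij => ι (p.1 ij.1 ij.2)

theorem inner_toVec {ι : 𝔽 →+ W} (hι : IsScalarEmbedding ι) (p q : ProjSpace 𝔽 d) :
    ∑ i, ∑ j, inner ℝ (p.1 i j) (q.1 i j) = inner ℝ (toVec ι p) (toVec ι q) := by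
  simp [toVec, PiLp.inner_apply, Fintype.sum_prod_type, hι.inner_eq]

theorem isTraceEmbedding_toVec {ι : 𝔽 →+ W} (hι : IsScalarEmbedding ι) :
    IsTraceEmbedding (toVec ι : ProjSpace 𝔽 d → _)
      (WithLp.toLp 2 fun ij => ι ((1 : Matrix (Fin (d + 1)) (Fin (d + 1)) 𝔽) ij.1 ij.2))
      (d + 1) where
  continuous := by
    refine (PiLp.continuous_toLp 2 _).comp (continuous_pi fun ij => hι.continuous.comp ?_)
    exact (continuous_apply_apply ij.1 ij.2).comp continuous_subtype_val
  injective p q hpq := by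
    refine Subtype.ext (Matrix.ext fun i j => hι.injective ?_)
    exact congrFun (WithLp.toLp_injective 2 hpq) (i, j)
  norm_eq p := by
    have h : ‖toVec ι p‖ ^ 2 = 1 := by
      have hs : ∀ i j, star (p.1 i j) = p.1 j i := fun i j => p.2.1.apply j i
      -- The squared norm is the real part of `tr (p p) = tr p = 1`, entry by entry, with no
      -- reassociation of products.
      calc ‖toVec ι p‖ ^ 2 = ∑ i, ∑ j, inner ℝ (ι 1) (ι (p.1 i j * p.1 j i)) := by
            simp [toVec, PiLp.norm_sq_eq_of_L2, Fintype.sum_prod_type, ← hι.inner_mul_star, hs]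
        _ = inner ℝ (ι 1) (ι (p.1 * p.1).trace) := by
            simp [Matrix.trace, Matrix.mul_apply, inner_sum]
        _ = 1 := by
            rw [p.2.2.1, p.2.2.2, real_inner_self_eq_norm_sq, hι.norm_one, one_pow]
    exact (pow_eq_one_iff_of_nonneg (norm_nonneg _) two_ne_zero).1 h
  inner_eq p := by
    have h : ∑ i, inner ℝ (ι 1) (ι (p.1 i i)) = 1 := by
      rw [← inner_sum, ← map_sum]
      change inner ℝ (ι 1) (ι p.1.trace) = 1
      rw [p.2.2.2, real_inner_self_eq_norm_sq, hι.norm_one, one_pow]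
    rw [← h]
    simp only [toVec, PiLp.inner_apply, Fintype.sum_prod_type, Matrix.one_apply]
    refine Finset.sum_congr rfl fun i _ => ?_
    rw [Finset.sum_eq_single i (fun j _ hj => by simp [hj.symm]) (by simp)]
    simp
  norm_sq := by
    simp only [PiLp.norm_sq_eq_of_L2, Fintype.sum_prod_type, Matrix.one_apply]
    rw [Finset.sum_congr rfl fun i _ => Finset.sum_eq_single i
      (fun j _ hj => by simp [hj.symm]) (by simp)]
    simp [hι.norm_one]

/-- The projection `c v vᵀ` onto the line of an integer vector `v`, where `c = 1 / |v|²`. -/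
def ofInt (v : Fin (d + 1) → ℤ) (c : 𝔽) (hc : star c = c) (hv : (∑ i, v i * v i) • c = 1) :
    ProjSpace 𝔽 d :=
  ⟨Matrix.of fun i j => (v i * v j) • c, by
    ext i j
    rw [Matrix.conjTranspose_apply, Matrix.of_apply, Matrix.of_apply, star_zsmul, hc, mul_comm], by
    ext i j
    -- All entries are integer multiples of one scalar, so associativity of `𝔽` is not needed.
    have : ∀ l, (v i * v l) • c * (v l * v j) • c = (v i * v j) • (((v l * v l) • c) * c) :=
      fun l => by
        rw [smul_mul_assoc, mul_smul_comm, smul_mul_assoc, smul_smul, smul_smul]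
        congr 1
        ring
    simp only [Matrix.mul_apply, Matrix.of_apply, this]
    rw [← Finset.smul_sum, ← Finset.sum_mul, ← Finset.sum_smul, hv, one_mul], by
    simp only [Matrix.trace, Matrix.diag, Matrix.of_apply]
    rw [← Finset.sum_smul, hv]⟩

/-- This is `⟨p, q⟩ = (v · w)² / (|v|² |w|²)` with denominators cleared, since `a` and `b` are known
only through `|v|² a = 1` and `|w|² b = 1`. -/
theorem inner_toVec_ofInt {ι : 𝔽 →+ W} (hι : IsScalarEmbedding ι) {v w : Fin (d + 1) → ℤ}
    {a b : 𝔽} (ha : star a = a) (hb : star b = b) (hv : (∑ i, v i * v i) • a = 1)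
    (hw : (∑ i, w i * w i) • b = 1) :
    ((∑ i, v i * v i : ℤ) * (∑ i, w i * w i : ℤ) : ℝ) *
      inner ℝ (toVec ι (ofInt v a ha hv)) (toVec ι (ofInt w b hb hw)) =
      ((∑ i, v i * w i : ℤ) : ℝ) ^ 2 := by
  have h1 : ((∑ i, v i * v i : ℤ) * (∑ i, w i * w i : ℤ) : ℝ) * inner ℝ (ι a) (ι b) = 1 := by
    have := congrArg₂ (fun x y => inner ℝ (ι x) (ι y)) hv hw
    simp only [map_zsmul, real_inner_self_eq_norm_sq, hι.norm_one] at this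
    simp only [← Int.cast_smul_eq_zsmul ℝ, real_inner_smul_left, real_inner_smul_right] at this
    linarith
  have h2 : inner ℝ (toVec ι (ofInt v a ha hv)) (toVec ι (ofInt w b hb hw)) =
      ((∑ i, v i * w i : ℤ) : ℝ) ^ 2 * inner ℝ (ι a) (ι b) := by
    simp only [toVec, ofInt, PiLp.inner_apply, Fintype.sum_prod_type, Matrix.of_apply, map_zsmul]
    simp only [← Int.cast_smul_eq_zsmul ℝ, real_inner_smul_left, real_inner_smul_right]
    push_cast
    rw [sq, Finset.sum_mul_sum, Finset.sum_mul]
    refine Finset.sum_congr rfl fun i _ => ?_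
    rw [Finset.sum_mul]
    exact Finset.sum_congr rfl fun j _ => by ring
  rw [h2]
  linear_combination ((∑ i, v i * w i : ℤ) : ℝ) ^ 2 * h1

end ProjSpace

/-- An orthogonal basis obtained from the standard one by a rotation by `π / 4` in the plane of
the first two coordinates, up to scaling. -/
def rotatedBasis {k : ℕ} (i : Fin (k + 2)) : Fin (k + 2) → ℤ :=
  if i = 0 then Pi.single 0 1 + Pi.single 1 1
  else if i = 1 then Pi.single 0 1 - Pi.single 1 1
  else Pi.single i 1

theorem val_lt_two_iff {k : ℕ} (i : Fin (k + 2)) : (i : ℕ) < 2 ↔ i = 0 ∨ i = 1 := by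
  simp only [Fin.ext_iff, Fin.val_zero, Fin.val_one]
  omega

theorem sum_rotatedBasis_mul {k : ℕ} (i j : Fin (k + 2)) :
    ∑ l, rotatedBasis i l * rotatedBasis j l =
      if i = j then if (i : ℕ) < 2 then 2 else 1 else 0 := by
  change rotatedBasis i ⬝ᵥ rotatedBasis j = _
  simp only [val_lt_two_iff, rotatedBasis]
  split_ifs <;> simp_all [add_dotProduct, sub_dotProduct, Pi.single_apply, eq_comm]

/-- Squaring removes the one negative coordinate; after division by the squared length, the block
entries become `1/2`, hence `ρ = 1/2`. -/
theorem sum_single_mul_rotatedBasis {k : ℕ} (i j : Fin (k + 2)) :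
    (∑ l, (Pi.single i 1 : Fin (k + 2) → ℤ) l * rotatedBasis j l) ^ 2 =
      if (i : ℕ) < 2 ∧ (j : ℕ) < 2 then 1 else if i = j then 1 else 0 := by
  have h01 : (0 : Fin (k + 2)) ≠ 1 := by simp
  change ((Pi.single i 1 : Fin (k + 2) → ℤ) ⬝ᵥ rotatedBasis j) ^ 2 = _
  rw [single_one_dotProduct]
  simp only [val_lt_two_iff, rotatedBasis]
  split_ifs <;> simp [Pi.single_apply] <;> grind

theorem ProjSpace.existsUnique_isONBThreshold_of_scalars [CompleteSpace W] [T2Space 𝔽]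
    [SecondCountableTopology 𝔽] {ι : 𝔽 →+ W} (hι : IsScalarEmbedding ι) {h : 𝔽} (hh : h + h = 1)
    (hs : star h = h) (hd : 1 ≤ d) :
    ∃! t : ℝ, t ∈ Set.Icc (-2 : ℝ) (-1) ∧ IsONBThreshold 𝔽 d t := by
  obtain ⟨k, rfl⟩ : ∃ k, d = k + 1 := ⟨d - 1, by omega⟩
  have : SecondCountableTopology (Matrix (Fin (k + 1 + 1)) (Fin (k + 1 + 1)) 𝔽) :=
    inferInstanceAs (SecondCountableTopology (Fin (k + 1 + 1) → Fin (k + 1 + 1) → 𝔽))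
  have : SecondCountableTopology (ProjSpace 𝔽 (k + 1)) :=
    Topology.IsEmbedding.subtypeVal.secondCountableTopology
  have : T1Space (ProjSpace 𝔽 (k + 1)) :=
    inferInstanceAs (T1Space {p : Matrix (Fin (k + 1 + 1)) (Fin (k + 1 + 1)) 𝔽 //
      p.IsHermitian ∧ p * p = p ∧ p.trace = 1})
  have he : ∀ i : Fin (k + 2), (∑ l, (Pi.single i 1 : Fin (k + 2) → ℤ) l *
      (Pi.single i 1 : Fin (k + 2) → ℤ) l) • (1 : 𝔽) = 1 := fun i => by simp [Pi.single_apply]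
  -- The first two rotated vectors have squared length 2, so they are normalized by `h`, which plays
  -- the role of `1/2`.
  have hc : ∀ i : Fin (k + 2), star (if (i : ℕ) < 2 then h else 1) = if (i : ℕ) < 2 then h else 1 :=
    fun i => by split_ifs <;> simp [hs]
  have hf : ∀ i : Fin (k + 2), (∑ l, rotatedBasis i l * rotatedBasis i l) •
      (if (i : ℕ) < 2 then h else 1) = 1 := fun i => by
    rw [sum_rotatedBasis_mul, if_pos rfl]
    split_ifs
    · rw [two_smul, hh]
    · rw [one_smul]
  refine existsUnique_isONBThreshold (isTraceEmbedding_toVec hι) (inner_toVec hι)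
    (e := fun i => ofInt (Pi.single i 1) 1 (star_one 𝔽) (he i))
    (f := fun i => ofInt (rotatedBasis i) _ (hc i) (hf i)) ?_ ?_ ?_
  · intro i j hij
    rw [angleRatio_eq_one_iff]
    have := inner_toVec_ofInt hι (star_one 𝔽) (star_one 𝔽) (he i) (he j)
    simp [Pi.single_apply, hij.symm] at this
    exact this.le
  · intro i j hij
    rw [angleRatio_eq_one_iff]
    have := inner_toVec_ofInt hι (hc i) (hc j) (hf i) (hf j)
    generalize inner ℝ (toVec ι (ofInt (rotatedBasis i) _ (hc i) (hf i)))
      (toVec ι (ofInt (rotatedBasis j) _ (hc j) (hf j))) = r at *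
    rw [sum_rotatedBasis_mul i j, if_neg hij, sum_rotatedBasis_mul, sum_rotatedBasis_mul, if_pos rfl,
      if_pos rfl] at this
    split_ifs at this <;> norm_num at this <;> exact this.le
  · intro i j
    have := inner_toVec_ofInt hι (star_one 𝔽) (hc j) (he i) (hf j)
    rw [← Int.cast_pow, sum_single_mul_rotatedBasis, sum_rotatedBasis_mul, if_pos rfl] at this
    by_cases h1 : (i : ℕ) < 2 ∧ (j : ℕ) < 2
    · rw [if_pos h1]
      refine angleRatio_eq_half ?_
      generalize inner ℝ (toVec ι (ofInt (Pi.single i 1) 1 (star_one 𝔽) (he i)))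
        (toVec ι (ofInt (rotatedBasis j) _ (hc j) (hf j))) = r at *
      rw [if_pos h1, if_pos h1.2] at this
      simp [Pi.single_apply] at this
      linarith
    rw [if_neg h1]
    by_cases h2 : i = j
    · have hj : ¬ (j : ℕ) < 2 := fun hj => h1 ⟨h2 ▸ hj, hj⟩
      rw [if_pos h2, angleRatio_eq_zero_iff]
      generalize inner ℝ (toVec ι (ofInt (Pi.single i 1) 1 (star_one 𝔽) (he i)))
        (toVec ι (ofInt (rotatedBasis j) _ (hc j) (hf j))) = r at *
      rw [if_neg h1, if_neg hj, if_pos h2] at this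
      simp [Pi.single_apply] at this
      exact this.ge
    · rw [if_neg h2, angleRatio_eq_one_iff]
      generalize inner ℝ (toVec ι (ofInt (Pi.single i 1) 1 (star_one 𝔽) (he i)))
        (toVec ι (ofInt (rotatedBasis j) _ (hc j) (hf j))) = r at *
      rw [if_neg h1, if_neg h2] at this
      simp only [Pi.single_apply] at this
      split_ifs at this <;> norm_num at this <;> exact this.le

end ScalarEmbedding

/-! ### The octonion norm and the four scalar systems -/

namespace Octonion

theorem inner_eq (x y : Octonion) :
    inner ℝ x y = inner ℝ x.left y.left + inner ℝ x.right y.right :=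
  WithLp.prod_inner_apply x y

theorem norm_one : ‖(1 : Octonion)‖ = 1 := by
  have h : ‖(1 : Octonion)‖ ^ 2 = 1 := by
    rw [← real_inner_self_eq_norm_sq, inner_eq]
    simp
  exact (pow_eq_one_iff_of_nonneg (norm_nonneg _) two_ne_zero).1 h

/-- For `a = (x, y)` the left component of `a a*` is `x x* + y* y`; the right one is paired with
zero. -/
theorem inner_one_mul_star (a : Octonion) : inner ℝ 1 (a * star a) = ‖a‖ ^ 2 := by
  rw [← real_inner_self_eq_norm_sq, inner_eq, inner_eq]
  simp [Quaternion.inner_def, Quaternion.self_mul_star, Quaternion.star_mul_self,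
    Quaternion.normSq_eq_norm_mul_self, sq]

end Octonion

theorem theorem7p4 :
    (∀ d : ℕ, 1 ≤ d → ∃! t : ℝ, t ∈ Set.Icc (-2 : ℝ) (-1) ∧ IsONBThreshold ℝ d t) ∧
    (∀ d : ℕ, 1 ≤ d → ∃! t : ℝ, t ∈ Set.Icc (-2 : ℝ) (-1) ∧ IsONBThreshold ℂ d t) ∧
    (∀ d : ℕ, 1 ≤ d → ∃! t : ℝ, t ∈ Set.Icc (-2 : ℝ) (-1) ∧ IsONBThreshold (Quaternion ℝ) d t) ∧
    (∀ d : ℕ, d = 1 ∨ d = 2 →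
      ∃! t : ℝ, t ∈ Set.Icc (-2 : ℝ) (-1) ∧ IsONBThreshold Octonion d t) := by
  have hH : ((1 / 2 : ℝ) : ℍ) + ((1 / 2 : ℝ) : ℍ) = 1 := by
    rw [← Quaternion.coe_add]
    norm_num
  refine ⟨fun d hd => ?_, fun d hd => ?_, fun d hd => ?_, fun d hd => ?_⟩
  · exact ProjSpace.existsUnique_isONBThreshold_of_scalars (ι := AddMonoidHom.id ℝ)
      ⟨continuous_id, fun _ _ h => h, fun _ _ => rfl, by simp, fun a => by simp [sq]⟩
      (h := 1 / 2) (by norm_num) (by simp) hd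
  · exact ProjSpace.existsUnique_isONBThreshold_of_scalars (ι := AddMonoidHom.id ℂ)
      ⟨continuous_id, fun _ _ h => h, fun _ _ => rfl, by simp, fun a => by
        simp [Complex.inner, ← Complex.normSq_eq_norm_sq, Complex.normSq_apply]⟩
      (h := 1 / 2) (by norm_num) (by simp) hd
  · exact ProjSpace.existsUnique_isONBThreshold_of_scalars (ι := AddMonoidHom.id ℍ)
      ⟨continuous_id, fun _ _ h => h, fun _ _ => rfl, by simp, fun a => by
        simp [Quaternion.inner_def, Quaternion.self_mul_star, Quaternion.normSq_eq_norm_mul_self, sq]⟩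
      (h := ((1 / 2 : ℝ) : ℍ)) hH (by simp) hd
  · have : SecondCountableTopology Octonion :=
      inferInstanceAs (SecondCountableTopology (WithLp 2 (ℍ × ℍ)))
    have : CompleteSpace Octonion := inferInstanceAs (CompleteSpace (WithLp 2 (ℍ × ℍ)))
    exact ProjSpace.existsUnique_isONBThreshold_of_scalars (ι := AddMonoidHom.id Octonion)
      ⟨continuous_id, fun _ _ h => h, fun _ _ => rfl, Octonion.norm_one, Octonion.inner_one_mul_star⟩
      (h := Octonion.mk ((1 / 2 : ℝ) : ℍ) 0)
      (Octonion.ext hH (add_zero _))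
      (by ext1 <;> simp) (by omega)
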